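/- Let $\alpha$ be a non-zero algebraic number. Let $h$ be the order of the torsion subgroup of the multiplicative group $H^\times$ (that is, the number of roots of unity in $H$), where $H$ is the splitting field over $\mathbb{Q}$ of the minimal polynomial of $\alpha$ over $\mathbb{Q}$, and let $\zeta$ be a primitive $h$-th root of unity. Then $\mathrm{Tr}_{\mathbb{Q}(\alpha,\zeta)/\mathbb{Q}(\zeta)}(\alpha^n) = 0$ for infinitely many $n \in \mathbb{N}$ if and only if $\alpha \notin \mathbb{Q}(\alpha^h,\zeta)$. -/

import Mathlib

open scoped IntermediateField

/-- The inclusion `ℚ(ζ) ⊆ ℚ(α, ζ)` of subfields of `ℂ`. -/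
theorem adjoin_root_le (α ζ : ℂ) : ℚ⟮ζ⟯ ≤ ℚ⟮α, ζ⟯ :=
  IntermediateField.adjoin.mono ℚ _ _ (by simp)

/-- The field `ℚ(α, ζ)`, regarded as an extension of `ℚ(ζ)`. -/
noncomputable abbrev extField (α ζ : ℂ) : IntermediateField ℚ⟮ζ⟯ ℂ :=
  IntermediateField.extendScalars (adjoin_root_le α ζ)

/-- The number `α` as an element of `ℚ(α, ζ)`. -/
noncomputable def extGen (α ζ : ℂ) : extField α ζ :=
  ⟨α, IntermediateField.subset_adjoin ℚ _ (by simp)⟩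

/-- The order of the torsion subgroup of the multiplicative group of the splitting field over `ℚ`
of the minimal polynomial of `α`. -/
noncomputable def splittingTorsionOrder (α : ℂ) : ℕ :=
  Nat.card (CommGroup.torsion ((minpoly ℚ α).SplittingField)ˣ)

/-! The trace of `α ^ n` is the sum of `σ(α) ^ n` over the embeddings `σ` of `ℚ(α, ζ)` over `ℚ(ζ)`.
If `α ∉ ℚ(α ^ h, ζ)`, some automorphism over `ℚ(ζ)` sends `α` to `w * α` with `w ≠ 1` and `w ^ h =
1` (`exists_algHom_extField`). Invariance of the trace then gives `Tr(α ^ n) = w ^ n * Tr(α ^ n)`,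
hence zero for all `n ≡ 1` mod `h`. If `α ∈ ℚ(α ^ h, ζ)`, distinct `σ, τ` never have `σ(α) / τ(α)` a
root of unity: its order would divide `h` (`pow_splittingTorsionOrder_eq`), so `σ` and `τ` would
agree on `α ^ h` and `ζ`, hence on `α`. The nondegenerate case of Skolem–Mahler–Lech
(`finite_zeros_of_nondegenerate`), proved by `p`-adic interpolation, leaves finitely many zeros. -/

section LocalFields

open Filter Topology

/-! ### Exponential sums over local fields. -/

/-- The exponential series of a normed algebra over `ℚ_[p]` has positive radius of convergence. -/
theorem expSeries_radius_pos_of_padic (p : ℕ) [hp : Fact p.Prime] (E : Type*)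
    [NontriviallyNormedField E] [NormedAlgebra ℚ_[p] E] :
    0 < (NormedSpace.expSeries E E).radius := by
  have hp0 : (0 : ℝ) < p := by exact_mod_cast hp.out.pos
  have hfac (n : ℕ) : ‖((n.factorial : E))⁻¹‖ ≤ (p : ℝ) ^ n := by
    rw [norm_inv, ← map_natCast (algebraMap ℚ_[p] E), norm_algebraMap',
      Padic.norm_eq_zpow_neg_valuation (Nat.cast_ne_zero.2 n.factorial_ne_zero),
      Padic.valuation_natCast, zpow_neg, inv_inv, zpow_natCast]
    refine pow_le_pow_right₀ (by exact_mod_cast hp.out.one_le) ?_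
    -- Legendre's formula: `(p - 1) * v_p(n!)` is `n` minus its base-`p` digit sum.
    calc padicValNat p n.factorial ≤ (p - 1) * padicValNat p n.factorial :=
          Nat.le_mul_of_pos_left _ (Nat.sub_pos_of_lt hp.out.one_lt)
      _ ≤ n := (sub_one_mul_padicValNat_factorial n).trans_le (Nat.sub_le _ _)
  refine lt_of_lt_of_le (b := (((p : NNReal)⁻¹ : NNReal) : ENNReal)) ?_
    (FormalMultilinearSeries.le_radius_of_bound _ 1 fun n ↦ ?_)
  · simp
  · calc ‖NormedSpace.expSeries E E n‖ * ((p : NNReal)⁻¹ : NNReal) ^ n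
        ≤ (p : ℝ) ^ n * ((p : NNReal)⁻¹ : NNReal) ^ n := by
          gcongr
          rw [NormedSpace.expSeries, norm_smul, ContinuousMultilinearMap.norm_mkPiAlgebraFin, mul_one]
          exact hfac n
      _ = 1 := by
          rw [← mul_pow]
          simp [hp0.ne']

/-- Near `0`, the exponential turns natural multiples into powers. -/
theorem exp_natCast_mul_of_mem_ball {E : Type*} [NontriviallyNormedField E] [CharZero E]
    [CompleteSpace E] [IsUltrametricDist E] {x : E}
    (hx : x ∈ Metric.eball (0 : E) (NormedSpace.expSeries E E).radius) (n : ℕ) :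
    NormedSpace.exp ((n : E) * x) = NormedSpace.exp x ^ n := by
  have hmul (n : ℕ) : (n : E) * x ∈ Metric.eball (0 : E) (NormedSpace.expSeries E E).radius := by
    rw [Metric.mem_eball, edist_zero_right] at hx ⊢
    refine lt_of_le_of_lt ?_ hx
    rw [enorm_le_iff_norm_le, norm_mul]
    exact mul_le_of_le_one_left (norm_nonneg _) (IsUltrametricDist.norm_natCast_le_one E n)
  induction n with
  | zero => simp
  | succ n ih =>
    rw [Nat.cast_succ, add_mul, one_mul, NormedSpace.exp_add_of_mem_ball (hmul n) hx, ih, pow_succ]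

/-- Finitely many elements of norm one have a common positive power close to one. -/
theorem exists_pow_dist_one_lt {E ι : Type*} [NormedField E] [ProperSpace E] [Finite ι]
    (a : ι → E) (ha : ∀ i, ‖a i‖ = 1) {δ : ℝ} (hδ : 0 < δ) :
    ∃ D : ℕ, 0 < D ∧ ∀ i, dist (a i ^ D) 1 < δ := by
  have := Fintype.ofFinite ι
  obtain ⟨x, -, φ, hφ, hx⟩ := (isCompact_closedBall (0 : ι → E) 1).tendsto_subseq
    (x := fun n ↦ a ^ n) fun n ↦ by
      rw [mem_closedBall_zero_iff, pi_norm_le_iff_of_nonneg zero_le_one]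
      simp [ha]
  obtain ⟨N, hN⟩ := Metric.cauchySeq_iff'.1 hx.cauchySeq δ hδ
  have hlt : φ N < φ (N + 1) := hφ N.lt_succ_self
  -- Two nearby powers; the smaller one has norm one and can be divided out.
  refine ⟨φ (N + 1) - φ N, Nat.sub_pos_of_lt hlt, fun i ↦ ?_⟩
  have h := (dist_le_pi_dist _ _ i).trans_lt (hN (N + 1) N.le_succ)
  obtain ⟨d, hd⟩ := Nat.exists_eq_add_of_le hlt.le
  simp only [Function.comp_apply, Pi.pow_apply, hd, dist_eq_norm, pow_add] at h
  rw [hd, Nat.add_sub_cancel_left, dist_eq_norm]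
  rwa [← mul_sub_one, norm_mul, norm_pow, ha, one_pow, one_mul] at h

/-- Powers of distinct elements are linearly independent as sequences. -/
theorem eq_zero_of_forall_sum_mul_pow_eq_zero {F ι : Type*} [Field F] [Fintype ι] {a c : ι → F}
    (ha : Function.Injective a) (h : ∀ n : ℕ, ∑ i, c i * a i ^ n = 0) (i : ι) : c i = 0 := by
  -- Dedekind's independence of characters, for the characters `n ↦ a i ^ n`.
  have hli := (linearIndependent_monoidHom (Multiplicative ℕ) F).comp
    (fun i ↦ powersHom F (a i)) fun i j hij ↦ ha ((powersHom F).injective hij)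
  refine Fintype.linearIndependent_iff.1 hli c (funext fun n ↦ ?_) i
  simpa [Finset.sum_apply] using h n.toAdd

/-- A function analytic on the closed unit ball of a proper ultrametric field that vanishes at
infinitely many natural numbers vanishes along an arithmetic progression. -/
theorem exists_arith_progression_of_infinite_zeros {E : Type*} [NontriviallyNormedField E]
    [CharZero E] [ProperSpace E] [IsUltrametricDist E] {G : E → E}
    (hG : AnalyticOnNhd E G (Metric.closedBall 0 1)) (hT : {k : ℕ | G k = 0}.Infinite) :
    ∃ k d : ℕ, 0 < d ∧ ∀ j : ℕ, G ((k + d * j : ℕ) : E) = 0 := by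
  have hsub : ((↑) : ℕ → E) '' {k : ℕ | G k = 0} ⊆ Metric.closedBall 0 1 := by
    rintro _ ⟨k, -, rfl⟩
    simpa using IsUltrametricDist.norm_natCast_le_one E k
  obtain ⟨z, hz, hacc⟩ := (hT.image Nat.cast_injective.injOn).exists_accPt_of_subset_isCompact
    (isCompact_closedBall (0 : E) 1) hsub
  have hfreq : ∃ᶠ x in 𝓝[≠] z, G x = 0 := by
    refine (accPt_iff_frequently_nhdsNE.1 hacc).mono ?_
    rintro _ ⟨k, hk, rfl⟩
    exact hk
  obtain ⟨ε, hε, hball⟩ := Metric.eventually_nhds_iff_ball.1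
    ((hG z hz).frequently_zero_iff_eventually_zero.1 hfreq)
  have hinf : {k : ℕ | (k : E) ∈ Metric.ball z ε}.Infinite := by
    refine Set.Infinite.of_image ((↑) : ℕ → E) ((Set.Infinite.of_accPt
      (hacc.nhds_inter (Metric.ball_mem_nhds z hε))).mono ?_)
    rintro _ ⟨hz', k, -, rfl⟩
    exact ⟨k, hz', rfl⟩
  obtain ⟨k, hk⟩ := hinf.nonempty
  obtain ⟨k', hk', hlt⟩ := hinf.exists_gt k
  obtain ⟨d, rfl⟩ := Nat.exists_eq_add_of_lt hlt
  refine ⟨k, d + 1, d.succ_pos, fun j ↦ hball _ ?_⟩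
  -- In an ultrametric ball of zeros, the difference of two members is small, and so are its natural
  -- multiples: the whole progression stays in the ball.
  have hd : ‖((d + 1 : ℕ) : E)‖ < ε := by
    have := (IsUltrametricDist.dist_triangle_max ((k + d + 1 : ℕ) : E) z k).trans_lt
      (max_lt hk' (by rwa [dist_comm]))
    rw [dist_eq_norm] at this
    simpa [add_assoc] using this
  refine (IsUltrametricDist.dist_triangle_max _ (k : E) z).trans_lt (max_lt ?_ hk)
  rw [dist_eq_norm, Nat.cast_add, add_sub_cancel_left, Nat.cast_mul, norm_mul]
  exact (mul_le_of_le_one_right (norm_nonneg _)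
    (IsUltrametricDist.norm_natCast_le_one E j)).trans_lt hd

/-- The Skolem–Mahler–Lech theorem for nondegenerate exponential sums whose bases are units of a
local field of characteristic zero. -/
theorem finite_zeros_of_norm_eq_one (p : ℕ) [Fact p.Prime] {E ι : Type*}
    [NontriviallyNormedField E] [NormedAlgebra ℚ_[p] E] [ProperSpace E] [IsUltrametricDist E]
    [Fintype ι] {a c : ι → E} (ha : ∀ i, ‖a i‖ = 1)
    (hnd : ∀ n : ℕ, 0 < n → Function.Injective fun i ↦ a i ^ n) (hc : ∃ i, c i ≠ 0) :
    {n : ℕ | ∑ i, c i * a i ^ n = 0}.Finite := by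
  have : CharZero E := charZero_of_injective_algebraMap (algebraMap ℚ_[p] E).injective
  by_contra hinf
  have hR := expSeries_radius_pos_of_padic p E
  have hnhds : NormedSpace.exp '' Metric.eball (0 : E) (NormedSpace.expSeries E E).radius ∈
      𝓝 (1 : E) := by
    have h := (hasStrictDerivAt_exp_zero_of_radius_pos hR).map_nhds_eq one_ne_zero
    rw [NormedSpace.exp_zero] at h
    exact h ▸ image_mem_map (Metric.eball_mem_nhds _ hR)
  obtain ⟨δ, hδ, hball⟩ := Metric.mem_nhds_iff.1 hnhds
  obtain ⟨D, hD, hdist⟩ := exists_pow_dist_one_lt a ha hδ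
  choose l hl hexp using fun i ↦ hball (hdist i)
  -- Pigeonhole: some residue class mod `D` contains infinitely many zeros.
  obtain ⟨r, hr⟩ : ∃ r : ℕ, {k : ℕ | ∑ i, c i * a i ^ (r + D * k) = 0}.Infinite := by
    by_contra! hfin
    refine hinf (((Set.finite_Iio D).biUnion fun r _ ↦
      (hfin r).image fun k ↦ r + D * k).subset ?_)
    intro n hn
    simp only [Set.mem_iUnion, Set.mem_image]
    exact ⟨n % D, Nat.mod_lt _ hD, n / D, by simpa [Nat.mod_add_div] using hn,
      Nat.mod_add_div _ _⟩
  -- Since `exp (l i) = a i ^ D`, `G` interpolates the sum along `r + D * k`.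
  let G : E → E := fun x ↦ ∑ i, c i * a i ^ r * NormedSpace.exp (x * l i)
  have hGk (k : ℕ) : G k = ∑ i, c i * a i ^ (r + D * k) := by
    refine Finset.sum_congr rfl fun i _ ↦ ?_
    rw [exp_natCast_mul_of_mem_ball (hl i), hexp, pow_add, pow_mul, mul_assoc]
  have hG : AnalyticOnNhd E G (Metric.closedBall 0 1) := by
    intro x hx
    refine Finset.analyticAt_fun_sum _ fun i _ ↦ analyticAt_const.mul ?_
    refine AnalyticAt.fun_comp (g := NormedSpace.exp) (NormedSpace.analyticAt_exp_of_mem_ball _ ?_)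
      (analyticAt_id.mul analyticAt_const)
    have := hl i
    rw [Metric.mem_eball, edist_zero_right] at this ⊢
    refine lt_of_le_of_lt ?_ this
    rw [enorm_le_iff_norm_le, norm_mul]
    exact mul_le_of_le_one_left (norm_nonneg _) (by simpa using hx)
  obtain ⟨k, d, hd, hzero⟩ := exists_arith_progression_of_infinite_zeros hG
    (by simpa only [hGk] using hr)
  obtain ⟨i, hi⟩ := hc
  -- Along the progression the bases are `a i ^ (D * d)`, distinct by nondegeneracy, so all
  -- coefficients vanish.
  refine hi ((mul_eq_zero.1 (eq_zero_of_forall_sum_mul_pow_eq_zero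
    (c := fun i ↦ c i * a i ^ (r + D * k)) (hnd (D * d) (Nat.mul_pos hD hd)) (fun j ↦ ?_)
    i)).resolve_right (pow_ne_zero _ (norm_ne_zero_iff.1 (by simp [ha]))))
  rw [← hzero j, hGk]
  refine Finset.sum_congr rfl fun i _ ↦ ?_
  rw [mul_assoc, ← pow_mul, ← pow_add]
  ring_nf

end LocalFields

/-! ### Reduction from algebraic numbers to local fields. -/

/-- Elements of an ultrametric field that are integral over `ℤ` have norm at most one. -/
theorem norm_le_one_of_isIntegral_int {E : Type*} [NormedField E] [IsUltrametricDist E] {x : E}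
    (hx : IsIntegral ℤ x) : ‖x‖ ≤ 1 := by
  have h := Valuation.Integers.mem_of_integral
    (Valuation.integer.integers (NormedField.valuation (K := E)))
    (hx.tower_top (A := (NormedField.valuation (K := E)).integer))
  simpa [Valuation.mem_integer_iff, NormedField.valuation_apply, ← NNReal.coe_le_coe] using h

/-- A nonzero algebraic number has norm one in every ultrametric field containing it whose norm does
not see a fixed integer. -/
theorem exists_int_forall_norm_eq_one {F : Type*} [Field F] [Algebra ℚ F] {x : F}
    (hx : IsAlgebraic ℚ x) (hx0 : x ≠ 0) :
    ∃ m : ℤ, m ≠ 0 ∧ ∀ {E : Type} [NormedField E] [IsUltrametricDist E] (f : F →+* E),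
      ‖(m : E)‖ = 1 → ‖f x‖ = 1 := by
  have halg := (IsFractionRing.isAlgebraic_iff ℤ ℚ F).2 hx
  obtain ⟨m₁, hm₁, hi₁⟩ := halg.exists_integral_multiple
  obtain ⟨m₂, hm₂, hi₂⟩ := halg.inv.exists_integral_multiple
  -- `m₁` and `m₂` clear the denominators of `x` and `x⁻¹`, which bounds `‖f x‖` on both sides.
  refine ⟨m₁ * m₂, mul_ne_zero hm₁ hm₂, fun {E} _ _ f hm ↦ ?_⟩
  have h₁ := norm_le_one_of_isIntegral_int (map_isIntegral_int f hi₁)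
  have h₂ := norm_le_one_of_isIntegral_int (map_isIntegral_int f hi₂)
  have hm₁' := IsUltrametricDist.norm_intCast_le_one E m₁
  have hm₂' := IsUltrametricDist.norm_intCast_le_one E m₂
  rw [Int.cast_mul, norm_mul] at hm
  have hu₁ : ‖(m₁ : E)‖ = 1 := by nlinarith [norm_nonneg (m₁ : E), norm_nonneg (m₂ : E)]
  have hu₂ : ‖(m₂ : E)‖ = 1 := by nlinarith [norm_nonneg (m₁ : E), norm_nonneg (m₂ : E)]
  simp only [zsmul_eq_mul, map_mul, map_intCast, norm_mul, hu₁, hu₂, one_mul, map_inv₀,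
    norm_inv] at h₁ h₂
  have hpos : 0 < ‖f x‖ := norm_pos_iff.2 ((map_ne_zero f).2 hx0)
  exact le_antisymm h₁ ((inv_le_one₀ hpos).1 h₂)

/-- The Skolem–Mahler–Lech theorem for nondegenerate exponential sums of algebraic numbers. -/
theorem finite_zeros_of_nondegenerate {F ι : Type*} [Field F] [Algebra ℚ F]
    [Algebra.IsAlgebraic ℚ F] [Fintype ι] {a c : ι → F} (ha : ∀ i, a i ≠ 0)
    (hnd : ∀ n : ℕ, 0 < n → Function.Injective fun i ↦ a i ^ n) (hc : ∃ i, c i ≠ 0) :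
    {n : ℕ | ∑ i, c i * a i ^ n = 0}.Finite := by
  have : CharZero F := algebraRat.charZero F
  choose m hm hnorm using fun i ↦
    exists_int_forall_norm_eq_one (Algebra.IsAlgebraic.isAlgebraic (R := ℚ) (a i)) (ha i)
  have hM : ∏ i, m i ≠ 0 := Finset.prod_ne_zero_iff.2 fun i _ ↦ hm i
  -- A prime exceeding the product divides no `m i`, so every `a i` becomes a `p`-adic unit.
  obtain ⟨p, hpM, hp⟩ := Nat.exists_infinite_primes ((∏ i, m i).natAbs + 1)
  have : Fact p.Prime := ⟨hp⟩
  have hpm (i : ι) : ¬ (p : ℤ) ∣ m i := fun h ↦ by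
    have := Nat.le_of_dvd (Int.natAbs_pos.2 hM)
      (Int.natCast_dvd.1 (h.trans (Finset.dvd_prod_of_mem m (Finset.mem_univ i))))
    omega
  let f : F →ₐ[ℚ] PadicAlgCl p := IsAlgClosed.lift
  -- Adjoining only the finitely many bases and coefficients keeps `E` finite over `ℚ_[p]`, hence
  -- proper.
  let E : IntermediateField ℚ_[p] (PadicAlgCl p) :=
    IntermediateField.adjoin ℚ_[p] (Set.range (f ∘ a) ∪ Set.range (f ∘ c))
  have hfin : FiniteDimensional ℚ_[p] E :=
    IntermediateField.finiteDimensional_adjoin (fun x _ ↦ Algebra.IsIntegral.isIntegral x)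
  have : ProperSpace E := FiniteDimensional.proper ℚ_[p] E
  have : IsUltrametricDist E := IsUltrametricDist.subtype _
  let a' (i : ι) : E := ⟨f (a i), IntermediateField.subset_adjoin _ _ (.inl ⟨i, rfl⟩)⟩
  let c' (i : ι) : E := ⟨f (c i), IntermediateField.subset_adjoin _ _ (.inr ⟨i, rfl⟩)⟩
  have key : {n : ℕ | ∑ i, c' i * a' i ^ n = 0}.Finite := by
    refine finite_zeros_of_norm_eq_one p (fun i ↦ hnorm i f.toRingHom ?_) (fun n hn i j hij ↦ ?_) ?_
    · rw [← map_intCast (algebraMap ℚ_[p] (PadicAlgCl p)), norm_algebraMap']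
      exact le_antisymm (Padic.norm_int_le_one _)
        (not_lt.1 fun h ↦ hpm i (Padic.norm_intCast_lt_one_iff.1 h))
    · refine hnd n hn (f.injective ?_)
      simpa [a', Subtype.ext_iff] using hij
    · obtain ⟨i, hi⟩ := hc
      exact ⟨i, fun h ↦ hi ((map_eq_zero f).1 (congrArg Subtype.val h))⟩
  refine key.subset fun n hn ↦ Subtype.ext ?_
  have := congrArg f hn
  simpa [a', c'] using this

/-! ### Roots of unity, conjugates and embeddings of `ℚ(α, ζ)`. -/

/-- The group of roots of unity of a number field is finite. -/
theorem finite_torsion_units_numberField (K : Type*) [Field K] [NumberField K] :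
    Finite (CommGroup.torsion Kˣ) := by
  refine Set.finite_coe_iff.2 (((NumberField.Embeddings.finite_of_norm_le K ℂ 1).preimage
    Units.val_injective.injOn).subset fun u hu ↦ ?_)
  obtain ⟨n, hn, hu⟩ := isOfFinOrder_iff_pow_eq_one.1 hu
  have hu' : (u : K) ^ n = 1 := by rw [← Units.val_pow_eq_pow_val, hu, Units.val_one]
  refine ⟨.of_pow hn (hu' ▸ isIntegral_one), fun φ ↦ ?_⟩
  exact (Complex.norm_eq_one_of_pow_eq_one (by rw [← map_pow, hu', map_one]) hn.ne').le


theorem splittingTorsionOrder_pos (α : ℂ) : 0 < splittingTorsionOrder α := by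
  have : NumberField (minpoly ℚ α).SplittingField := { }
  have := finite_torsion_units_numberField (minpoly ℚ α).SplittingField
  exact Nat.card_pos

/-- If the ratio of two conjugates of `α` is a root of unity, then its order divides the number of
roots of unity in the splitting field. -/
theorem pow_splittingTorsionOrder_eq {α x y : ℂ} (hα : IsAlgebraic ℚ α) (hα0 : α ≠ 0)
    (hx : Polynomial.aeval x (minpoly ℚ α) = 0) (hy : Polynomial.aeval y (minpoly ℚ α) = 0) {n : ℕ}
    (hn : 0 < n) (hxy : x ^ n = y ^ n) :
    x ^ splittingTorsionOrder α = y ^ splittingTorsionOrder α := by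
  let f : (minpoly ℚ α).SplittingField →ₐ[ℚ] ℂ := IsAlgClosed.lift
  have hlift {z : ℂ} (hz : Polynomial.aeval z (minpoly ℚ α) = 0) : ∃ z', f z' = z ∧ z' ≠ 0 := by
    have hz0 : z ≠ 0 := by
      rintro rfl
      rw [← Polynomial.coeff_zero_eq_aeval_zero', map_eq_zero] at hz
      exact minpoly.coeff_zero_ne_zero hα.isIntegral hα0 hz
    obtain ⟨z', rfl⟩ : z ∈ f.toRingHom.range := by
      refine (Polynomial.SplittingField.splits (minpoly ℚ α)).mem_range_of_isRoot
        (Polynomial.map_ne_zero (minpoly.ne_zero hα.isIntegral)) ?_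
      rw [Polynomial.map_map, Polynomial.IsRoot.def, Polynomial.eval_map]
      convert hz
      rw [Polynomial.aeval_def]
      congr 1
      exact Subsingleton.elim _ _
    exact ⟨z', rfl, fun h ↦ hz0 (by simp [h])⟩
  obtain ⟨x', rfl, hx0⟩ := hlift hx
  obtain ⟨y', rfl, hy0⟩ := hlift hy
  rw [← map_pow, ← map_pow] at hxy ⊢
  have hxy' := f.injective hxy
  congr 1
  let u : (minpoly ℚ α).SplittingFieldˣ := Units.mk0 x' hx0 / Units.mk0 y' hy0
  have hu : u ∈ CommGroup.torsion (minpoly ℚ α).SplittingFieldˣ := by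
    refine isOfFinOrder_iff_pow_eq_one.2 ⟨n, hn, Units.ext ?_⟩
    simp [u, div_pow, hxy', hy0]
  have h1 : u ^ splittingTorsionOrder α = 1 :=
    congrArg Subtype.val (pow_card_eq_one' (x := (⟨u, hu⟩ : CommGroup.torsion _)))
  simpa [u, div_pow, div_eq_one_iff_eq, hy0] using congrArg Units.val h1

theorem finiteDimensional_extField {α ζ : ℂ} (hα : IsAlgebraic ℚ α) (hζ : IsAlgebraic ℚ ζ) :
    FiniteDimensional ℚ⟮ζ⟯ (extField α ζ) := by
  rw [extField, IntermediateField.extendScalars_adjoin]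
  refine IntermediateField.finiteDimensional_adjoin fun x hx ↦ ?_
  obtain rfl | rfl := hx
  exacts [hα.isIntegral.tower_top, hζ.isIntegral.tower_top]

/-- Two homomorphisms on `ℚ(α, ζ)` that agree on a set agree on the field it generates. -/
theorem algHom_extField_eq_of_mem_adjoin {α ζ : ℂ} {σ τ : extField α ζ →ₐ[ℚ⟮ζ⟯] ℂ} {S : Set ℂ}
    (hS : ∀ s ∈ S, ∃ y : extField α ζ, (y : ℂ) = s ∧ σ y = τ y) (y : extField α ζ)
    (hy : (y : ℂ) ∈ IntermediateField.adjoin ℚ S) : σ y = τ y := by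
  obtain ⟨z, hz, h⟩ : ∃ z : extField α ζ, (z : ℂ) = y ∧ σ z = τ z := by
    generalize (y : ℂ) = x at hy
    induction hy using IntermediateField.adjoin_induction with
    | mem s hs => exact hS s hs
    | algebraMap q => exact ⟨(q : extField α ζ), by simp, by simp⟩
    | add x y _ _ hx hy =>
      obtain ⟨x, rfl, hx⟩ := hx
      obtain ⟨y, rfl, hy⟩ := hy
      exact ⟨x + y, rfl, by rw [map_add, map_add, hx, hy]⟩
    | inv x _ hx =>
      obtain ⟨x, rfl, hx⟩ := hx
      exact ⟨x⁻¹, rfl, by rw [map_inv₀, map_inv₀, hx]⟩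
    | mul x y _ _ hx hy =>
      obtain ⟨x, rfl, hx⟩ := hx
      obtain ⟨y, rfl, hy⟩ := hy
      exact ⟨x * y, rfl, by rw [map_mul, map_mul, hx, hy]⟩
  rwa [← Subtype.ext hz]

/-- The image of `ζ` in `ℚ(α, ζ)`. -/
noncomputable def extRoot (α ζ : ℂ) : extField α ζ :=
  algebraMap ℚ⟮ζ⟯ (extField α ζ) (IntermediateField.AdjoinSimple.gen ℚ ζ)

/-- Every embedding of `ℚ(α, ζ)` maps `α` to one of its conjugates over `ℚ`. -/
theorem aeval_extGen_minpoly {α ζ : ℂ} (σ : extField α ζ →ₐ[ℚ⟮ζ⟯] ℂ) :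
    Polynomial.aeval (σ (extGen α ζ)) (minpoly ℚ α) = 0 := by
  have h : Polynomial.aeval (extGen α ζ) (minpoly ℚ α) = 0 := by
    apply (algebraMap (extField α ζ) ℂ).injective
    rw [← Polynomial.aeval_algebraMap_apply, map_zero]
    exact minpoly.aeval ℚ α
  have := Polynomial.aeval_algHom_apply (σ.restrictScalars ℚ) (extGen α ζ) (minpoly ℚ α)
  rwa [h, map_zero] at this

/-! ### The two directions. -/

/-- If `α` lies in `ℚ(α ^ h, ζ)`, only finitely many powers of `α` have trace zero. -/
theorem finite_trace_zeros {α ζ : ℂ} (hα : IsAlgebraic ℚ α) (hα0 : α ≠ 0)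
    (hζ : IsAlgebraic ℚ ζ) (hmem : α ∈ ℚ⟮α ^ splittingTorsionOrder α, ζ⟯) :
    {n : ℕ | Algebra.trace ℚ⟮ζ⟯ (extField α ζ) (extGen α ζ ^ n) = 0}.Finite := by
  have := finiteDimensional_extField hα hζ
  have hgen0 : extGen α ζ ≠ 0 := fun h ↦ hα0 (congrArg Subtype.val h)
  let a (σ : extField α ζ →ₐ[ℚ⟮ζ⟯] ℂ) : algebraicClosure ℚ ℂ :=
    ⟨σ (extGen α ζ), mem_algebraicClosure_iff.2
      ⟨_, minpoly.ne_zero hα.isIntegral, aeval_extGen_minpoly σ⟩⟩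
  have hnd (n : ℕ) (hn : 0 < n) : Function.Injective fun σ ↦ a σ ^ n := by
    intro σ τ h
    have hpow := pow_splittingTorsionOrder_eq hα hα0 (aeval_extGen_minpoly σ)
      (aeval_extGen_minpoly τ) hn (congrArg Subtype.val h)
    have hζ' : ∃ y : extField α ζ, (y : ℂ) = ζ ∧ σ y = τ y :=
      ⟨extRoot α ζ, rfl, by rw [extRoot, σ.commutes, τ.commutes]⟩
    have hα' : σ (extGen α ζ) = τ (extGen α ζ) := by
      refine algHom_extField_eq_of_mem_adjoin (fun s hs ↦ ?_) _ hmem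
      obtain rfl | rfl := hs
      exacts [⟨extGen α ζ ^ splittingTorsionOrder α, rfl, by rw [map_pow, map_pow, hpow]⟩, hζ']
    refine AlgHom.ext fun y ↦ algHom_extField_eq_of_mem_adjoin (fun s hs ↦ ?_) y y.2
    obtain rfl | rfl := hs
    exacts [⟨extGen s ζ, rfl, hα'⟩, hζ']
  have : Algebra.IsAlgebraic ℚ (algebraicClosure ℚ ℂ) := by
    convert algebraicClosure.isAlgebraic ℚ ℂ
    exacts [rfl, Subsingleton.elim _ _]
  have key := finite_zeros_of_nondegenerate (a := a) (c := fun _ ↦ 1)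
    (fun σ h ↦ hgen0 ((map_eq_zero σ).1 (congrArg Subtype.val h))) hnd
    ⟨(extField α ζ).val, one_ne_zero⟩
  refine key.subset fun n hn ↦ Subtype.ext ?_
  have h := trace_eq_sum_embeddings (K := ℚ⟮ζ⟯) ℂ (x := extGen α ζ ^ n)
  rw [hn, map_zero] at h
  simpa [a] using h.symm

/-- If `α` does not lie in `ℚ(α ^ h, ζ)`, some endomorphism of `ℚ(α, ζ)` over `ℚ(ζ)` multiplies `α`
by a nontrivial `h`-th root of unity. -/
theorem exists_algHom_extField {α ζ : ℂ} (hα : IsAlgebraic ℚ α) {h : ℕ} (hh : 0 < h)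
    (hζ : IsPrimitiveRoot ζ h) (hmem : α ∉ ℚ⟮α ^ h, ζ⟯) :
    ∃ (φ : extField α ζ →ₐ[ℚ⟮ζ⟯] extField α ζ) (w : ℚ⟮ζ⟯), w ≠ 1 ∧ w ^ h = 1 ∧
      φ (extGen α ζ) = w • extGen α ζ := by
  let M := ℚ⟮α ^ h, ζ⟯
  have hα0 : α ≠ 0 := fun h0 ↦ hmem (h0 ▸ zero_mem _)
  have hint : IsIntegral M α := hα.isIntegral.tower_top
  have hKM : ℚ⟮ζ⟯ ≤ M := IntermediateField.adjoin.mono ℚ _ _ (by simp)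
  -- By separability `α ∉ M` has another conjugate `β` over `M`; as `α ^ h ∈ M`, `β / α` is an
  -- `h`-th root of unity, so a power of `ζ`.
  obtain ⟨β, hne, hβ⟩ := (notMem_iff_exists_ne_and_isConjRoot
    (minpoly.irreducible hint).separable (IsAlgClosed.splits _)).1
    (show α ∉ (⊥ : Subalgebra M ℂ) by
      rintro ⟨x, hx⟩
      have hxM := x.2
      rw [show (x : ℂ) = α from hx] at hxM
      exact hmem hxM)
  obtain ⟨g, hg⟩ : ∃ g : M⟮α⟯ →ₐ[M] ℂ, g (IntermediateField.AdjoinSimple.gen M α) = β :=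
    ⟨_, IntermediateField.algHomAdjoinIntegralEquiv_symm_apply_gen M hint
      ⟨β, Polynomial.mem_aroots.2 ⟨minpoly.ne_zero hint, hβ.aeval_eq_zero⟩⟩⟩
  have hgM (x : ℂ) (hx : x ∈ M) (hx' : x ∈ M⟮α⟯) : g ⟨x, hx'⟩ = x := g.commutes ⟨x, hx⟩
  have hpow : β ^ h = α ^ h := by
    rw [← hg, ← map_pow]
    exact hgM _ (IntermediateField.subset_adjoin _ _ (by simp)) _
  have : NeZero h := ⟨hh.ne'⟩
  obtain ⟨j, -, hj⟩ := hζ.eq_pow_of_pow_eq_one (ξ := β / α)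
    (by rw [div_pow, hpow, div_self (pow_ne_zero _ hα0)])
  have hβ' : β = ζ ^ j * α := by rw [hj, div_mul_cancel₀ _ hα0]
  have hζM : ζ ∈ M := IntermediateField.subset_adjoin _ _ (by simp)
  have hαL : α ∈ ℚ⟮α, ζ⟯ := IntermediateField.subset_adjoin _ _ (by simp)
  have hζL : ζ ∈ ℚ⟮α, ζ⟯ := IntermediateField.subset_adjoin _ _ (by simp)
  have hle : ℚ⟮α, ζ⟯ ≤ M⟮α⟯.restrictScalars ℚ := by
    rw [IntermediateField.adjoin_le_iff]
    rintro x (rfl | rfl)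
    · exact IntermediateField.mem_adjoin_simple_self M x
    · exact M⟮α⟯.algebraMap_mem ⟨x, hζM⟩
  let ψ : ℚ⟮α, ζ⟯ →ₐ[ℚ] ℂ := (g.restrictScalars ℚ).comp (IntermediateField.inclusion hle)
  have hψM (y : ℚ⟮α, ζ⟯) (hy : (y : ℂ) ∈ M) : ψ y = y := hgM y hy _
  have hψα : ψ ⟨α, hαL⟩ = β := hg
  have hmap (y : ℚ⟮α, ζ⟯) : ψ y ∈ ℚ⟮α, ζ⟯ := by
    have hle' : ℚ⟮α, ζ⟯ ≤ (ℚ⟮α, ζ⟯.comap ψ).map ℚ⟮α, ζ⟯.val := by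
      refine IntermediateField.adjoin_le_iff.2 ?_
      rintro x (rfl | rfl)
      · exact ⟨⟨x, hαL⟩, show ψ _ ∈ _ by rw [hψα, hβ']; exact mul_mem (pow_mem hζL j) hαL, rfl⟩
      · exact ⟨⟨x, hζL⟩, show ψ ⟨x, hζL⟩ ∈ ℚ⟮α, x⟯ by rw [hψM ⟨x, hζL⟩ hζM]; exact hζL, rfl⟩
    obtain ⟨z, hz, hzy⟩ := hle' y.2
    rwa [← Subtype.ext hzy]
  let φ : extField α ζ →ₐ[ℚ⟮ζ⟯] extField α ζ :=
    { (ψ : ℚ⟮α, ζ⟯ →+* ℂ).codRestrict ℚ⟮α, ζ⟯ hmap with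
      commutes' := fun x ↦ Subtype.ext (hψM _ (hKM x.2)) }
  refine ⟨φ, IntermediateField.AdjoinSimple.gen ℚ ζ ^ j, fun h1 ↦ hne ?_, ?_, ?_⟩
  · have h1' : ζ ^ j = 1 := congrArg Subtype.val h1
    rw [hβ', h1', one_mul]
  · refine Subtype.ext ?_
    change (ζ ^ j) ^ h = 1
    rw [hj, div_pow, hpow, div_self (pow_ne_zero _ hα0)]
  · exact Subtype.ext (hψα.trans hβ')

/-- If `α` does not lie in `ℚ(α ^ h, ζ)`, infinitely many powers of `α` have trace zero. -/
theorem infinite_trace_zeros {α ζ : ℂ} (hα : IsAlgebraic ℚ α) {h : ℕ} (hh : 0 < h)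
    (hζ : IsPrimitiveRoot ζ h) (hmem : α ∉ ℚ⟮α ^ h, ζ⟯) :
    {n : ℕ | Algebra.trace ℚ⟮ζ⟯ (extField α ζ) (extGen α ζ ^ n) = 0}.Infinite := by
  have := finiteDimensional_extField hα (hζ.isIntegral hh).tower_top.isAlgebraic
  obtain ⟨φ, w, hw1, hwh, hφ⟩ := exists_algHom_extField hα hh hζ hmem
  -- Exponents `n = h * k + 1` give `w ^ n = w ≠ 1`.
  refine Set.infinite_of_injective_forall_mem (f := fun k ↦ h * k + 1) (fun k l hkl ↦ ?_)
    fun k ↦ ?_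
  · exact Nat.eq_of_mul_eq_mul_left hh (Nat.succ_injective hkl)
  · let e := AlgEquiv.ofBijective φ (Algebra.IsAlgebraic.algHom_bijective φ)
    have he : e (extGen α ζ ^ (h * k + 1)) = w • extGen α ζ ^ (h * k + 1) := by
      rw [map_pow, AlgEquiv.coe_ofBijective, hφ, smul_pow, pow_succ w, pow_mul w, hwh, one_pow,
        one_mul]
    have ht := Algebra.trace_eq_of_algEquiv e (extGen α ζ ^ (h * k + 1))
    rw [he, map_smul, smul_eq_mul] at ht
    exact (mul_left_eq_self₀.1 ht).resolve_left hw1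

theorem mainTheorem5 (α : ℂ) (hα : IsAlgebraic ℚ α) (hα0 : α ≠ 0)
    (h : ℕ) (hh : h = splittingTorsionOrder α) (ζ : ℂ) (hζ : IsPrimitiveRoot ζ h) :
    {n : ℕ | Algebra.trace ℚ⟮ζ⟯ (extField α ζ) (extGen α ζ ^ n) = 0}.Infinite ↔
      α ∉ ℚ⟮α ^ h, ζ⟯ := by
  have hpos : 0 < h := hh ▸ splittingTorsionOrder_pos α
  refine ⟨fun hinf hmem ↦ hinf ?_, infinite_trace_zeros hα hpos hζ⟩
  exact finite_trace_zeros hα hα0 (hζ.isIntegral hpos).tower_top.isAlgebraic (hh ▸ hmem)
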